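/- Let $d \ge 2$, let $K \subset \mathbb{R}^d$ be compact, let $0 < \alpha_m < \alpha_M < 1$, let $\alpha_* \in [\alpha_m,\alpha_M]$, and let $\kappa : K \to [\alpha_m,\alpha_M]$ be measurable. Put $\alpha(x) = \kappa(x)$ for $x \in K$ and $\alpha(x) = \alpha_*$ for $x \in \mathbb{R}^d \setminus K$. Here $-\Delta$ is the operator in $L^2(\mathbb{R}^d)$ (complex valued functions) with domain $H^2(\mathbb{R}^d)$, functions of $x$ act as multiplication operators, and "invertible" means that the operator is a bijection from its domain onto $L^2(\mathbb{R}^d)$ with inverse in the space $\mathcal{B}(L^2(\mathbb{R}^d))$ of bounded operators. 1. For all $r \in (0,+\infty)$ and $\beta \in (-\pi,\pi)$, the operator $-\Delta + r^{\alpha(x)} e^{i\alpha(x)\beta}$ is invertible, and $$\big\| \big(-\Delta + r^{\alpha(x)} e^{i\alpha(x)\beta}\big)^{-1} \big\|_{\mathcal{B}(L^2(\mathbb{R}^d))} \le C_\beta \max_{j=m,M} r^{-\alpha_j},$$ where $C_\beta = 1$ if $\beta = 0$ and $C_\beta = \max_{j=m,M} |\sin(\alpha_j \beta)|^{-1}$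 if $\beta \ne 0$. Moreover, for every $p \in \mathbb{C} \setminus (-\infty,0]$ the operator $-\Delta + p^{\alpha(x)}$ (principal branch of the power) is invertible, and the map $p \mapsto (-\Delta + p^{\alpha(x)})^{-1}$ is holomorphic from $\mathbb{C} \setminus (-\infty,0]$ to $\mathcal{B}(L^2(\mathbb{R}^d))$ with its operator norm. 2. If $\kappa = \alpha_*$ on $K$ (hence $\alpha = \alpha_*$ on $\mathbb{R}^d$), then for all $r \in (0,+\infty)$ and $\beta \in (-\pi,\pi)$ the operator $-\Delta + r^{\alpha_*} e^{i\alpha_*\beta}$ is invertible, and $$\big\| \big(-\Delta + r^{\alpha_*} e^{i\alpha_*\beta}\big)^{-1} \big\|_{\mathcal{B}(L^2(\mathbb{R}^d))} \le C_\beta\, r^{-\alpha_*},$$ where $C_\beta = 1$ if $\beta = 0$ and $C_\beta = |\sin(\alpha_*\beta)|^{-1}$ if $\beta \ne 0$. Moreover, for every $p \in \mathbb{C} \setminus (-\infty,0]$ the operator $-\Delta + p^{\alpha_*}$ is invertible, and the map $p \mapsto (-\Delta + p^{\alpha_*})^{-1}$ is holomorphic from $\mathbb{C} \setminus (-\infty,0]$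 to $\mathcal{B}(L^2(\mathbb{R}^d))$. Equalities and bounds for $\kappa$ and $\alpha$ may be understood almost everywhere. -/

import Mathlib

open MeasureTheory TemperedDistribution
open scoped ENNReal Laplacian SchwartzMap

noncomputable section

/-- The Euclidean space of dimension `d`. -/
abbrev RSpace (d : ℕ) : Type := EuclideanSpace ℝ (Fin d)

/-- The complex Hilbert space `L²` of the Euclidean space, for Lebesgue measure. -/
abbrev L2Space (d : ℕ) : Type := Lp ℂ 2 (volume : Measure (RSpace d))

/-- The Sobolev space `H²`, as a subspace of `L²`. -/
def sobolevTwo (d : ℕ) : Submodule ℂ (L2Space d) where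
  carrier := {u | MemSobolev 2 2 (u : 𝓢'(RSpace d, ℂ))}
  zero_mem' := by
    simp only [Set.mem_ofPred_eq, ← Lp.toTemperedDistributionCLM_apply, map_zero]
    exact memSobolev_fun_zero _ _ _ _
  add_mem' := by
    intro u v hu hv
    simp only [Set.mem_ofPred_eq, ← Lp.toTemperedDistributionCLM_apply, map_add] at *
    exact hu.add hv
  smul_mem' := by
    intro c u hu
    simp only [Set.mem_ofPred_eq, ← Lp.toTemperedDistributionCLM_apply, map_smul] at *
    exact hu.smul c

/-- The distributional Laplacian of an `H²` function is represented by an `L²` function. -/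
theorem exists_neg_laplacian (d : ℕ) (u : sobolevTwo d) :
    ∃ v : L2Space d, (v : 𝓢'(RSpace d, ℂ)) = -Δ ((u : L2Space d) : 𝓢'(RSpace d, ℂ)) := by
  have h : MemSobolev 2 2 ((u : L2Space d) : 𝓢'(RSpace d, ℂ)) := u.2
  have h2 := h.laplacian.neg
  rw [sub_self, memSobolev_zero_iff] at h2
  obtain ⟨v, hv⟩ := h2
  exact ⟨v, hv.symm⟩

/-- An `L²` function is determined by its tempered distribution. -/
theorem l2_toTemperedDistribution_injective (d : ℕ) (v w : L2Space d)
    (h : (v : 𝓢'(RSpace d, ℂ)) = (w : 𝓢'(RSpace d, ℂ))) : v = w := by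
  simp only [← Lp.toTemperedDistributionCLM_apply] at h
  exact LinearMap.ker_eq_bot.mp
    (Lp.ker_toTemperedDistributionCLM_eq_bot (F := ℂ) (p := 2)
      (μ := (volume : Measure (RSpace d)))) h

/-- The operator `-Δ` in `L²`, with domain `H²`: its value at `u` is the `L²` function that
represents minus the distributional Laplacian of `u`. -/
def negLaplacian (d : ℕ) : L2Space d →ₗ.[ℂ] L2Space d where
  domain := sobolevTwo d
  toFun :=
    { toFun := fun u => (exists_neg_laplacian d u).choose
      map_add' := by
        intro u v
        apply l2_toTemperedDistribution_injective
        rw [(exists_neg_laplacian d (u + v)).choose_spec]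
        have hu := (exists_neg_laplacian d u).choose_spec
        have hv := (exists_neg_laplacian d v).choose_spec
        simp only [← Lp.toTemperedDistributionCLM_apply, Submodule.coe_add, map_add] at *
        rw [hu, hv]
        simp only [← laplacianCLM_apply, map_add, neg_add]
      map_smul' := by
        intro c u
        apply l2_toTemperedDistribution_injective
        rw [(exists_neg_laplacian d (c • u)).choose_spec]
        have hu := (exists_neg_laplacian d u).choose_spec
        simp only [← Lp.toTemperedDistributionCLM_apply, Submodule.coe_smul, map_smul,
          RingHom.id_apply] at *
        rw [hu]
        simp only [← laplacianCLM_apply, map_smul, smul_neg] }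

/-- The maximal domain `{u ∈ L² : q u ∈ L²}` of the multiplication operator by `q` (all of `L²`
if `q` is measurable and essentially bounded). -/
def mulDomain (d : ℕ) (q : RSpace d → ℂ) : Submodule ℂ (L2Space d) where
  carrier := {u | MemLp (fun x => q x * u x) 2 volume}
  zero_mem' := by
    have h : (fun x => q x * (0 : L2Space d) x) =ᵐ[volume] fun _ => (0 : ℂ) := by
      filter_upwards [Lp.coeFn_zero ℂ 2 (volume : Measure (RSpace d))] with x hx
      rw [hx, Pi.zero_apply, mul_zero]
    exact (memLp_congr_ae h).mpr MemLp.zero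
  add_mem' := by
    intro u v hu hv
    have h : (fun x => q x * (u + v) x) =ᵐ[volume] fun x => q x * u x + q x * v x := by
      filter_upwards [Lp.coeFn_add u v] with x hx
      rw [hx, Pi.add_apply, mul_add]
    exact (memLp_congr_ae h).mpr (MemLp.add hu hv)
  smul_mem' := by
    intro c u hu
    have h : (fun x => q x * (c • u) x) =ᵐ[volume] fun x => c * (q x * u x) := by
      filter_upwards [Lp.coeFn_smul c u] with x hx
      rw [hx, Pi.smul_apply, smul_eq_mul, mul_left_comm]
    exact (memLp_congr_ae h).mpr (MemLp.const_mul hu c)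

/-- The product of `q` and of a function of the maximal domain, as an element of `L²`. -/
def mulFun (d : ℕ) (q : RSpace d → ℂ) (u : mulDomain d q) : L2Space d :=
  MemLp.toLp (fun x => q x * (u : L2Space d) x) u.2

theorem coeFn_mulFun (d : ℕ) (q : RSpace d → ℂ) (u : mulDomain d q) :
    mulFun d q u =ᵐ[volume] fun x => q x * (u : L2Space d) x :=
  MemLp.coeFn_toLp u.2

/-- The multiplication operator by `q` in `L²`, with its maximal domain. -/
def mulOp (d : ℕ) (q : RSpace d → ℂ) : L2Space d →ₗ.[ℂ] L2Space d where
  domain := mulDomain d q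
  toFun :=
    { toFun := mulFun d q
      map_add' := by
        intro u v
        apply Lp.ext
        filter_upwards [coeFn_mulFun d q (u + v), coeFn_mulFun d q u, coeFn_mulFun d q v,
          Lp.coeFn_add (mulFun d q u) (mulFun d q v),
          Lp.coeFn_add (u : L2Space d) (v : L2Space d)] with x h1 h2 h3 h4 h5
        rw [h1, h4, Pi.add_apply, h2, h3, Submodule.coe_add, h5, Pi.add_apply, mul_add]
      map_smul' := by
        intro c u
        apply Lp.ext
        filter_upwards [coeFn_mulFun d q (c • u), coeFn_mulFun d q u,
          Lp.coeFn_smul c (mulFun d q u),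
          Lp.coeFn_smul c (u : L2Space d)] with x h1 h2 h3 h4
        rw [RingHom.id_apply, h1, h3, Pi.smul_apply, h2, Submodule.coe_smul, h4, Pi.smul_apply,
          smul_eq_mul, smul_eq_mul, mul_left_comm] }

/-- The operator `-Δ + q` in `L²` (the sum of two unbounded operators, defined on the
intersection of their domains, which is `H²` for bounded measurable `q`). -/
def schrodinger (d : ℕ) (q : RSpace d → ℂ) : L2Space d →ₗ.[ℂ] L2Space d :=
  negLaplacian d + mulOp d q

/-- `R` is the bounded inverse of the unbounded operator `A`: it is an everywhere defined bounded
operator with `A R = 1` and with `R A = 1` on the domain of `A`. It is unique if it exists. -/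
def IsBoundedInverse {d : ℕ} (A : L2Space d →ₗ.[ℂ] L2Space d)
    (R : L2Space d →L[ℂ] L2Space d) : Prop :=
  (∀ f : L2Space d, ∃ h : R f ∈ A.domain, A ⟨R f, h⟩ = f) ∧
    ∀ u : A.domain, R (A u) = (u : L2Space d)

open Classical in
/-- The variable order: `κ` on `K`, and the constant `αs` outside `K`. -/
def variableOrder {d : ℕ} (K : Set (RSpace d)) (κ : RSpace d → ℝ) (αs : ℝ) (x : RSpace d) : ℝ :=
  if x ∈ K then κ x else αs

/-- The constant `C_β` attached to the two orders `a` and `b`. -/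
def resolventConst (a b β : ℝ) : ℝ :=
  if β = 0 then 1 else max |Real.sin (a * β)|⁻¹ |Real.sin (b * β)|⁻¹

/-- The potential `x ↦ r ^ α(x) * exp (i α(x) β)`. -/
def polarPotential {d : ℕ} (α : RSpace d → ℝ) (r β : ℝ) (x : RSpace d) : ℂ :=
  ((r ^ α x : ℝ) : ℂ) * Complex.exp (Complex.I * (α x : ℂ) * (β : ℂ))

/-- The potential `x ↦ p ^ α(x)`, with the principal determination of the power. -/
def powerPotential {d : ℕ} (α : RSpace d → ℝ) (p : ℂ) (x : RSpace d) : ℂ :=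
  p ^ (α x : ℂ)

end

/-!
The resolvent `(-Δ + z)⁻¹`, for `Re z ≥ 0` and `z ≠ 0`, is the Fourier multiplier with symbol
`1 / (4 π² |ξ|² + z)`, whose modulus is at most `1 / |z|` (`exists_free_resolvent`). No quadratic
form is needed to pass from the constant `z` to a bounded potential `q`: suppose that the values of
`q` lie in a half-plane `Re (conj ω q) ≥ c > 0`, where `|ω| = 1` and `Re ω ≥ 0`. A bounded part of
that half-plane lies in the disc of centre `T ω` and radius `T - c'`, for each `c' < c` and `T` large
(`norm_sub_le_of_le_re`), so that `-Δ + q` is a perturbation of `-Δ + T ω` by an operator of norm at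
most `T - c'`, less than `1 / ‖(-Δ + T ω)⁻¹‖`. A Neumann series gives the inverse, and the same
comparison gives `‖(-Δ + q) u‖ ≥ c' ‖u‖`, hence the bound `1 / c` in the limit `c' → c`
(`exists_isBoundedInverse_of_le_re`).

For `q = r ^ α * exp (i α β)` the direction `ω` is `1` if `β = 0` and `± i` otherwise. The lower
bound `c` is the inverse of the constant of the theorem, since both `r ^ t` and the sine of `t |β|`
attain their minimum over an interval of orders `t` at one of its ends
(`exists_direction_of_mem_Ioo`, `inv_max_rpow_neg_le`).

For the holomorphy, `p ^ α = exp (α log p)` is a holomorphic family of bounded multiplication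
operators (`differentiable_mulLinfty_exp`), and `(A + N)⁻¹ = (1 + R (N - M))⁻¹ R` with
`R = (A + M)⁻¹` reduces the inverse of the unbounded operator to an inversion in the Banach algebra
of bounded operators (`IsShiftInverse.differentiableOn`).
-/

/-! ### Bounded perturbations of an unbounded operator -/

section AbstractInverse

variable {E : Type*} [NormedAddCommGroup E] [NormedSpace ℂ E]

/-- `R` is the everywhere defined bounded inverse of `A + M`, for an unbounded operator `A` and a
bounded operator `M`; the domain of the sum is the domain of `A`. -/
def IsShiftInverse (A : E →ₗ.[ℂ] E) (M R : E →L[ℂ] E) : Prop :=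
  (∀ f : E, ∃ h : R f ∈ A.domain, A ⟨R f, h⟩ + M (R f) = f) ∧
    ∀ u : A.domain, R (A u + M u) = u

namespace IsShiftInverse

variable {A : E →ₗ.[ℂ] E} {M N R S : E →L[ℂ] E}

/-- Factorisation of an inverse by a Neumann-type factor: since `A + N = (1 + (N - M) R) (A + M)`
with `R = (A + M)⁻¹`, invertibility of the bounded factor gives that of `A + N`. -/
theorem mul_of_mul_eq_one (h : IsShiftInverse A M R) {B : E →L[ℂ] E}
    (h₁ : (1 + (N - M) * R) * B = 1) (h₂ : B * (1 + (N - M) * R) = 1) :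
    IsShiftInverse A N (R * B) := by
  refine ⟨fun f => ?_, fun u => ?_⟩
  · obtain ⟨hd, hf⟩ := h.1 (B f)
    refine ⟨hd, ?_⟩
    have h3 := congrArg (fun T : E →L[ℂ] E => T f) h₁
    simp only [mul_apply_eq_comp, add_apply,
      one_apply_eq_self, sub_apply] at h3
    have h4 : A ⟨R (B f), hd⟩ = B f - M (R (B f)) := eq_sub_of_add_eq hf
    change A ⟨R (B f), hd⟩ + N (R (B f)) = f
    rw [h4]
    exact Eq.trans (by abel) h3
  · have h3 := congrArg (fun T : E →L[ℂ] E => T (A u + M u)) h₂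
    simp only [mul_apply_eq_comp, add_apply,
      one_apply_eq_self, sub_apply, h.2 u] at h3
    have h4 : A u + N u = A u + M u + (N u - M u) := by abel
    rw [mul_apply_eq_comp, h4, h3, h.2 u]

/-- The second resolvent identity. -/
theorem sub_eq (hR : IsShiftInverse A M R) (hS : IsShiftInverse A N S) :
    R - S = R * (N - M) * S := by
  ext f
  obtain ⟨hd, hf⟩ := hS.1 f
  have h1 := hR.2 ⟨S f, hd⟩
  have h2 : A ⟨S f, hd⟩ = f - N (S f) := eq_sub_of_add_eq hf
  rw [h2] at h1
  simp only [mul_apply_eq_comp, sub_apply]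
  simp only [map_add, map_sub] at h1 ⊢
  linear_combination (norm := module) h1

/-- If `A + M` and `A + N` are both invertible, so is the bounded operator
`1 + (A + M)⁻¹ (N - M) = (A + M)⁻¹ (A + N)`; its inverse is `1 - (A + N)⁻¹ (N - M)`. -/
theorem isUnit_one_add (hR : IsShiftInverse A M R) (hS : IsShiftInverse A N S) :
    IsUnit (1 + R * (N - M)) := by
  refine isUnit_iff_exists.mpr ⟨1 - S * (N - M), ?_, ?_⟩
  · have h := hR.sub_eq hS
    calc (1 + R * (N - M)) * (1 - S * (N - M))
        = 1 + ((R - S) - R * (N - M) * S) * (N - M) := by noncomm_ring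
      _ = 1 := by rw [h, sub_self, zero_mul, add_zero]
  · have h := hS.sub_eq hR
    calc (1 - S * (N - M)) * (1 + R * (N - M))
        = 1 - ((S - R) - S * (M - N) * R) * (N - M) := by noncomm_ring
      _ = 1 := by rw [h, sub_self, zero_mul, sub_zero]

/-- Any inverse of `A + N` is obtained from one fixed inverse `R` of `A + M` by inverting a bounded
operator that is affine in `N`. -/
theorem eq_inverse_mul (hR : IsShiftInverse A M R) (hS : IsShiftInverse A N S) :
    S = Ring.inverse (1 + R * (N - M)) * R := by
  have hu := hR.isUnit_one_add hS
  have h : (1 + R * (N - M)) * S = R := by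
    rw [add_mul, one_mul, ← hR.sub_eq hS]
    abel
  nth_rewrite 2 [← h]
  rw [← mul_assoc, Ring.inverse_mul_cancel _ hu, one_mul]

/-- Invertibility persists under small bounded perturbations. -/
theorem exists_of_norm_lt [CompleteSpace E] (h : IsShiftInverse A M R)
    (hN : ‖N - M‖ * ‖R‖ < 1) : ∃ S, IsShiftInverse A N S := by
  have hlt : ‖-((N - M) * R)‖ < 1 := by
    rw [norm_neg]
    exact (norm_mul_le _ _).trans_lt hN
  have hu : IsUnit (1 + (N - M) * R) := by
    have := (Units.oneSub _ hlt).isUnit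
    simpa using this
  exact ⟨_, h.mul_of_mul_eq_one (Ring.mul_inverse_cancel _ hu) (Ring.inverse_mul_cancel _ hu)⟩

/-- If `‖(A + M)⁻¹‖ ≤ 1 / T` and `‖N - M‖ ≤ T - c`, then `‖(A + N) u‖ ≥ c ‖u‖`. -/
theorem mul_norm_apply_le (hR : IsShiftInverse A M R) (hS : IsShiftInverse A N S)
    {T c : ℝ} (hT : 0 < T) (hRT : ‖R‖ ≤ T⁻¹) (hNM : ‖N - M‖ ≤ T - c) (f : E) :
    c * ‖S f‖ ≤ ‖f‖ := by
  obtain ⟨hd, hf⟩ := hS.1 f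
  have h1 := hR.2 ⟨S f, hd⟩
  have h2 : A ⟨S f, hd⟩ + M (S f) = f - (N - M) (S f) := by
    rw [eq_sub_of_add_eq hf, sub_apply]
    abel
  rw [h2] at h1
  have h3 : ‖S f‖ ≤ T⁻¹ * (‖f‖ + (T - c) * ‖S f‖) := by
    calc ‖S f‖ = ‖R (f - (N - M) (S f))‖ := by rw [h1]
      _ ≤ ‖R‖ * ‖f - (N - M) (S f)‖ := R.le_opNorm _
      _ ≤ T⁻¹ * (‖f‖ + (T - c) * ‖S f‖) := by
        gcongr
        exact (norm_sub_le _ _).trans (by gcongr; exact (N - M).le_of_opNorm_le hNM _)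
  rw [inv_mul_eq_div, le_div_iff₀ hT] at h3
  linarith

/-- The inverse of `A + M p` depends holomorphically on `p` if `M` does. -/
theorem differentiableOn [CompleteSpace E] {s : Set ℂ} {N S : ℂ → E →L[ℂ] E}
    (hR : IsShiftInverse A M R) (hN : DifferentiableOn ℂ N s)
    (hS : ∀ p ∈ s, IsShiftInverse A (N p) (S p)) : DifferentiableOn ℂ S s := by
  have h : DifferentiableOn ℂ (fun p => Ring.inverse (1 + R * (N p - M)) * R) s := by
    intro p hp
    have h1 : DifferentiableWithinAt ℂ (fun p => 1 + R * (N p - M)) s p :=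
      (((hN p hp).sub_const M).const_mul R).const_add 1
    exact ((differentiableAt_inverse (𝕜 := ℂ)
      (hR.isUnit_one_add (hS p hp))).comp_differentiableWithinAt p h1).mul_const R
  exact h.congr fun p hp => hR.eq_inverse_mul (hS p hp)

end IsShiftInverse

end AbstractInverse

/-! ### Multiplication by bounded functions -/

section Multiplication

variable {d : ℕ}

/-- Multiplication of `L²` functions by `L^∞` functions, as a bounded bilinear map. -/
noncomputable def mulLinfty (d : ℕ) :
    Lp ℂ ∞ (volume : Measure (RSpace d)) →L[ℂ] L2Space d →L[ℂ] L2Space d :=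
  (ContinuousLinearMap.mul ℂ ℂ).holderL volume ∞ 2 2

theorem coeFn_mulLinfty {q : RSpace d → ℂ} (hq : MemLp q ∞ volume) (u : L2Space d) :
    mulLinfty d hq.toLp u =ᵐ[volume] fun x => q x * u x := by
  filter_upwards [(ContinuousLinearMap.mul ℂ ℂ).coeFn_holder (r := 2) hq.toLp u, hq.coeFn_toLp]
    with x h1 h2
  rw [← h2]
  exact h1

theorem norm_mulLinfty_le {q : RSpace d → ℂ} (hq : MemLp q ∞ volume) {C : ℝ} (hC : 0 ≤ C)
    (h : ∀ᵐ x, ‖q x‖ ≤ C) : ‖mulLinfty d hq.toLp‖ ≤ C := by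
  refine ContinuousLinearMap.opNorm_le_bound _ hC fun u => ?_
  refine Lp.norm_le_mul_norm_of_ae_le_mul ?_
  filter_upwards [coeFn_mulLinfty hq u, h] with x h1 h2
  rw [h1, norm_mul]
  gcongr

/-- For a bounded potential, the inverses of `-Δ + q` as a sum of two unbounded operators are those
of the perturbation of `-Δ` by a bounded operator. -/
theorem isBoundedInverse_schrodinger_iff {q : RSpace d → ℂ} (hq : MemLp q ∞ volume)
    (R : L2Space d →L[ℂ] L2Space d) :
    IsBoundedInverse (schrodinger d q) R ↔
      IsShiftInverse (negLaplacian d) (mulLinfty d hq.toLp) R := by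
  have hdom (u : L2Space d) : u ∈ mulDomain d q :=
    (memLp_congr_ae (coeFn_mulLinfty hq u)).mp (Lp.memLp _)
  have hval (u : L2Space d) : mulFun d q ⟨u, hdom u⟩ = mulLinfty d hq.toLp u := by
    apply Lp.ext
    filter_upwards [coeFn_mulFun d q ⟨u, hdom u⟩, coeFn_mulLinfty hq u] with x h1 h2
    rw [h1, h2]
  constructor
  · rintro ⟨h1, h2⟩
    refine ⟨fun f => ?_, fun u => ?_⟩
    · obtain ⟨hd, hf⟩ := h1 f
      refine ⟨hd.1, ?_⟩
      rw [← hval]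
      exact hf
    · rw [← hval]
      exact h2 ⟨u, u.2, hdom u⟩
  · rintro ⟨h1, h2⟩
    refine ⟨fun f => ?_, fun u => ?_⟩
    · obtain ⟨hd, hf⟩ := h1 f
      refine ⟨⟨hd, hdom _⟩, ?_⟩
      rw [← hval] at hf
      exact hf
    · have := h2 ⟨u, u.2.1⟩
      rw [← hval] at this
      exact this

end Multiplication

/-! ### The free resolvent as a Fourier multiplier -/

section FreeResolvent

open FourierTransform Real

variable {d : ℕ}

/-- For `L²` functions, multiplication by a function of temperate growth in the sense of
distributions is pointwise multiplication, even when the product is only known to lie in `L²`. -/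
theorem smulLeftCLM_eq_iff_ae {g : RSpace d → ℂ} (hg : g.HasTemperateGrowth) (U V : L2Space d) :
    smulLeftCLM ℂ g (U : 𝓢'(RSpace d, ℂ)) = (V : 𝓢'(RSpace d, ℂ)) ↔
      ∀ᵐ x, g x * U x = V x := by
  constructor
  · intro h
    have hU : LocallyIntegrable (fun x => g x * U x) volume :=
      ((Lp.memLp U).locallyIntegrable (by norm_num)).continuous_mul hg.1.continuous
    have hV : LocallyIntegrable (V : RSpace d → ℂ) volume :=
      (Lp.memLp V).locallyIntegrable (by norm_num)
    refine ae_eq_of_integral_contDiff_smul_eq hU hV fun φ hφ hφc => ?_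
    have h₁ : HasCompactSupport (Complex.ofRealCLM ∘ φ) := hφc.comp_left rfl
    have h₂ : ContDiff ℝ ((⊤ : ℕ∞) : WithTop ℕ∞) (Complex.ofRealCLM ∘ φ) := by fun_prop
    have h3 := congrArg (fun T : 𝓢'(RSpace d, ℂ) => T (h₁.toSchwartzMap h₂)) h
    simp only [smulLeftCLM_apply_apply, Lp.toTemperedDistribution_apply,
      SchwartzMap.smulLeftCLM_apply_apply hg] at h3
    refine Eq.trans (integral_congr_ae (Filter.Eventually.of_forall fun x => ?_))
      (h3.trans (integral_congr_ae (Filter.Eventually.of_forall fun x => ?_)))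
    · simp
      ring
    · simp
  · intro h
    ext φ
    simp only [smulLeftCLM_apply_apply, Lp.toTemperedDistribution_apply,
      SchwartzMap.smulLeftCLM_apply_apply hg]
    refine integral_congr_ae ?_
    filter_upwards [h] with x hx
    rw [← hx]
    simp only [smul_eq_mul]
    ring

/-- `H²` on the Fourier side, as an almost everywhere statement about `L²` functions. -/
theorem mem_sobolevTwo_iff (u : L2Space d) :
    u ∈ sobolevTwo d ↔ ∃ w : L2Space d, ∀ᵐ ξ, (((1 + ‖ξ‖ ^ 2 : ℝ) : ℂ)) * 𝓕 u ξ = w ξ := by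
  change MemSobolev 2 2 (u : 𝓢'(RSpace d, ℂ)) ↔ _
  rw [memSobolev_iff_exists_smulLeftCLM_fourier, Lp.fourier_toTemperedDistribution_eq]
  refine exists_congr fun w => ?_
  rw [smulLeftCLM_eq_iff_ae (by fun_prop)]
  simp

/-- On the Fourier side, `-Δ` is multiplication by `4 π² |ξ|²`. -/
theorem fourier_negLaplacian (u : (negLaplacian d).domain) :
    ∀ᵐ ξ, 𝓕 (negLaplacian d u) ξ = (((2 * π) ^ 2 * ‖ξ‖ ^ 2 : ℝ) : ℂ) * 𝓕 (u : L2Space d) ξ := by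
  have h : ((negLaplacian d u : L2Space d) : 𝓢'(RSpace d, ℂ)) =
      -Δ ((u : L2Space d) : 𝓢'(RSpace d, ℂ)) := (exists_neg_laplacian d u).choose_spec
  have h2 := congrArg (fun T : 𝓢'(RSpace d, ℂ) => 𝓕 T) h
  simp only [Lp.fourier_toTemperedDistribution_eq, laplacian_eq_fourierMultiplierCLM] at h2
  rw [← neg_smul, neg_neg, ← Complex.coe_smul, ← smul_apply,
    ← TemperedDistribution.fourierMultiplierCLM_smul (by fun_prop),
    fourierMultiplierCLM_apply, fourier_fourierInv_eq, Lp.fourier_toTemperedDistribution_eq] at h2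
  filter_upwards [(smulLeftCLM_eq_iff_ae (by fun_prop) _ _).mp h2.symm] with ξ hξ
  rw [← hξ]
  simp

/-- The symbol `1 / (4 π² |ξ|² + z)` of the free resolvent; the factor `4 π²` comes from the
normalisation `exp (-2 π i x ξ)` of the Fourier transform. -/
noncomputable def resolventSymbol (z : ℂ) (ξ : RSpace d) : ℂ :=
  ((((2 * π) ^ 2 * ‖ξ‖ ^ 2 : ℝ) : ℂ) + z)⁻¹

theorem norm_le_norm_ofReal_add_of_re_nonneg {s : ℝ} (hs : 0 ≤ s) {z : ℂ} (hz : 0 ≤ z.re) :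
    ‖z‖ ≤ ‖(s : ℂ) + z‖ := by
  rw [Complex.norm_eq_sqrt_sq_add_sq, Complex.norm_eq_sqrt_sq_add_sq]
  apply Real.sqrt_le_sqrt
  simp only [Complex.add_re, Complex.ofReal_re, Complex.add_im, Complex.ofReal_im, zero_add]
  gcongr
  linarith

theorem le_norm_ofReal_add_of_re_nonneg (s : ℝ) {z : ℂ} (hz : 0 ≤ z.re) :
    s ≤ ‖(s : ℂ) + z‖ := by
  refine le_trans ?_ (Complex.re_le_norm _)
  simp [hz]

theorem ofReal_add_ne_zero_of_re_nonneg {s : ℝ} (hs : 0 ≤ s) {z : ℂ} (hz : 0 ≤ z.re)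
    (hz0 : z ≠ 0) : (s : ℂ) + z ≠ 0 :=
  norm_pos_iff.mp ((norm_pos_iff.mpr hz0).trans_le (norm_le_norm_ofReal_add_of_re_nonneg hs hz))

theorem continuous_resolventSymbol {z : ℂ} (hz : 0 ≤ z.re) (hz0 : z ≠ 0) :
    Continuous (resolventSymbol z : RSpace d → ℂ) := by
  exact Continuous.inv₀ (by fun_prop) fun ξ =>
    ofReal_add_ne_zero_of_re_nonneg (by positivity) hz hz0

theorem norm_resolventSymbol_le {z : ℂ} (hz : 0 ≤ z.re) (hz0 : z ≠ 0) (ξ : RSpace d) :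
    ‖resolventSymbol z ξ‖ ≤ ‖z‖⁻¹ := by
  rw [resolventSymbol, norm_inv]
  exact inv_anti₀ (norm_pos_iff.mpr hz0) (norm_le_norm_ofReal_add_of_re_nonneg (by positivity) hz)

/-- The symbol gains two derivatives, so that the free resolvent maps `L²` to `H²`. -/
theorem norm_one_add_mul_resolventSymbol_le {z : ℂ} (hz : 0 ≤ z.re) (hz0 : z ≠ 0)
    (ξ : RSpace d) :
    ‖((1 + ‖ξ‖ ^ 2 : ℝ) : ℂ) * resolventSymbol z ξ‖ ≤ ‖z‖⁻¹ + 1 := by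
  have hpos := norm_pos_iff.mpr hz0
  have h1 := norm_le_norm_ofReal_add_of_re_nonneg (s := (2 * π) ^ 2 * ‖ξ‖ ^ 2) (by positivity) hz
  have h2 := le_norm_ofReal_add_of_re_nonneg ((2 * π) ^ 2 * ‖ξ‖ ^ 2) hz
  rw [resolventSymbol, norm_mul, norm_inv, Complex.norm_real, Real.norm_of_nonneg (by positivity),
    ← div_eq_mul_inv, div_le_iff₀ (hpos.trans_le h1), add_mul, one_mul]
  refine add_le_add ?_ (le_trans ?_ h2)
  · rw [inv_mul_eq_div, le_div_iff₀ hpos, one_mul]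
    exact h1
  · have : (1 : ℝ) ≤ (2 * π) ^ 2 := one_le_pow₀ (by linarith [Real.pi_gt_three])
    nlinarith [sq_nonneg ‖ξ‖]

/-- The free resolvent: for `Re z ≥ 0`, `z ≠ 0`, the Fourier multiplier with symbol
`1 / (4 π² |ξ|² + z)` inverts `-Δ + z`, with norm at most `1 / |z|`. -/
theorem exists_free_resolvent (d : ℕ) {z : ℂ} (hz : 0 ≤ z.re) (hz0 : z ≠ 0) :
    ∃ R : L2Space d →L[ℂ] L2Space d,
      IsShiftInverse (negLaplacian d) (z • 1) R ∧ ‖R‖ ≤ ‖z‖⁻¹ := by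
  have hm : MemLp (resolventSymbol z : RSpace d → ℂ) ∞ volume :=
    memLp_top_of_bound (continuous_resolventSymbol hz hz0).aestronglyMeasurable _
      (Filter.Eventually.of_forall (norm_resolventSymbol_le hz hz0))
  have hm' : MemLp (fun ξ : RSpace d => ((1 + ‖ξ‖ ^ 2 : ℝ) : ℂ) * resolventSymbol z ξ) ∞ volume :=
    memLp_top_of_bound (Continuous.aestronglyMeasurable
      (Continuous.mul (by fun_prop) (continuous_resolventSymbol hz hz0))) _
      (Filter.Eventually.of_forall (norm_one_add_mul_resolventSymbol_le hz hz0))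
  have hne (ξ : RSpace d) : (((2 * π) ^ 2 * ‖ξ‖ ^ 2 : ℝ) : ℂ) + z ≠ 0 :=
    ofReal_add_ne_zero_of_re_nonneg (by positivity) hz hz0
  let F := Lp.fourierTransformₗᵢ (RSpace d) ℂ
  let R : L2Space d →L[ℂ] L2Space d :=
    (F.symm.toContinuousLinearEquiv : L2Space d →L[ℂ] L2Space d) ∘L
      mulLinfty d hm.toLp ∘L (F.toContinuousLinearEquiv : L2Space d →L[ℂ] L2Space d)
  have hFR (f : L2Space d) : 𝓕 (R f) = mulLinfty d hm.toLp (𝓕 f) := F.apply_symm_apply _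
  have hR (f : L2Space d) : ∀ᵐ ξ, 𝓕 (R f) ξ = resolventSymbol z ξ * 𝓕 f ξ := by
    rw [hFR]
    exact coeFn_mulLinfty hm (𝓕 f)
  have hadd (v w : L2Space d) : ∀ᵐ ξ, 𝓕 (v + z • w) ξ = 𝓕 v ξ + z * 𝓕 w ξ := by
    rw [FourierTransform.fourier_add, FourierTransform.fourier_smul]
    filter_upwards [Lp.coeFn_add (𝓕 v) (z • 𝓕 w), Lp.coeFn_smul z (𝓕 w)] with ξ h1 h2
    rw [h1, Pi.add_apply, h2, Pi.smul_apply, smul_eq_mul]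
  have hinj {v w : L2Space d} (h : ∀ᵐ ξ, 𝓕 v ξ = 𝓕 w ξ) : v = w := F.injective (Lp.ext h)
  refine ⟨R, ⟨fun f => ?_, fun u => ?_⟩, ?_⟩
  · have hd : R f ∈ (negLaplacian d).domain := by
      refine (mem_sobolevTwo_iff _).mpr ⟨mulLinfty d hm'.toLp (𝓕 f), ?_⟩
      filter_upwards [hR f, coeFn_mulLinfty hm' (𝓕 f)] with ξ h1 h2
      rw [h1, h2, mul_assoc]
    refine ⟨hd, hinj ?_⟩
    filter_upwards [hadd (negLaplacian d ⟨R f, hd⟩) (R f), fourier_negLaplacian ⟨R f, hd⟩, hR f]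
      with ξ h1 h2 h3
    refine h1.trans ?_
    rw [h2, h3, ← add_mul, resolventSymbol, mul_inv_cancel_left₀ (hne ξ)]
  · refine hinj ?_
    filter_upwards [hadd (negLaplacian d u) u, fourier_negLaplacian u,
      hR (negLaplacian d u + z • (u : L2Space d))] with ξ h1 h2 h3
    refine h3.trans ?_
    rw [h1, h2, ← add_mul, resolventSymbol, inv_mul_cancel_left₀ (hne ξ)]
  · refine ContinuousLinearMap.opNorm_le_bound _ (by positivity) fun f => ?_
    rw [← Lp.norm_fourier_eq (R f), hFR, ← Lp.norm_fourier_eq f]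
    exact ContinuousLinearMap.le_of_opNorm_le _ (norm_mulLinfty_le hm (by positivity)
      (Filter.Eventually.of_forall (norm_resolventSymbol_le hz hz0))) _

end FreeResolvent

/-! ### Potentials with values in a half-plane -/

section SectorialPotentials

variable {d : ℕ}

/-- A bounded set in the half-plane `Re (conj ω z) ≥ c`, `|ω| = 1`, lies in the disc of centre `T ω`
and radius `T - c'`, for every `c' < c` and all large `T`. -/
theorem norm_sub_le_of_le_re {ω : ℂ} (hω : ‖ω‖ = 1) {c c' C T : ℝ} (hT : c' ≤ T)
    (hTC : C ^ 2 - c' ^ 2 ≤ 2 * T * (c - c')) (hT0 : 0 ≤ T) {z : ℂ} (hz : ‖z‖ ≤ C)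
    (hzc : c ≤ (z * (starRingEnd ℂ) ω).re) : ‖z - (T : ℂ) * ω‖ ≤ T - c' := by
  have h1 : Complex.normSq (z - (T : ℂ) * ω) =
      ‖z‖ ^ 2 + T ^ 2 - 2 * (T * (z * (starRingEnd ℂ) ω).re) := by
    rw [Complex.normSq_sub, Complex.normSq_mul, Complex.normSq_ofReal,
      Complex.normSq_eq_norm_sq ω, hω, Complex.normSq_eq_norm_sq, map_mul, Complex.conj_ofReal,
      mul_left_comm, Complex.re_ofReal_mul]
    ring
  refine abs_le_of_sq_le_sq' ?_ (sub_nonneg.mpr hT) |>.2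
  rw [← Complex.normSq_eq_norm_sq, h1]
  have h2 : ‖z‖ ^ 2 ≤ C ^ 2 := by gcongr
  have h3 := mul_le_mul_of_nonneg_left hzc hT0
  linarith

/-- If the bounded potential `q` takes its values in a half-plane `Re (conj ω q) ≥ c > 0` with
`|ω| = 1` and `Re ω ≥ 0`, then `-Δ + q` is invertible with inverse of norm at most `1 / c`. -/
theorem exists_isBoundedInverse_of_le_re {q : RSpace d → ℂ} (hq : AEStronglyMeasurable q volume)
    {ω : ℂ} (hω : ‖ω‖ = 1) (hω0 : 0 ≤ ω.re) {c C : ℝ} (hc : 0 < c) (hqC : ∀ᵐ x, ‖q x‖ ≤ C)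
    (hqc : ∀ᵐ x, c ≤ (q x * (starRingEnd ℂ) ω).re) :
    ∃ R, IsBoundedInverse (schrodinger d q) R ∧ ‖R‖ ≤ c⁻¹ := by
  have hq' : MemLp q ∞ volume := memLp_top_of_bound hq C hqC
  simp only [isBoundedInverse_schrodinger_iff hq']
  -- For each `c' < c`, the operator is compared with the constant potential `T ω` with `T` large.
  have key (c' : ℝ) (hc' : 0 < c') (hcc : c' < c) : ∃ (T : ℝ) (R : L2Space d →L[ℂ] L2Space d),
      0 < T ∧ IsShiftInverse (negLaplacian d) (((T : ℂ) * ω) • 1) R ∧ ‖R‖ ≤ T⁻¹ ∧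
        ‖mulLinfty d hq'.toLp - ((T : ℂ) * ω) • 1‖ ≤ T - c' := by
    set T := max c' (C ^ 2 / (2 * (c - c'))) with hTdef
    have hT : c' ≤ T := le_max_left _ _
    have hT0 : 0 < T := hc'.trans_le hT
    have hTC : C ^ 2 - c' ^ 2 ≤ 2 * T * (c - c') := by
      have h := le_max_right c' (C ^ 2 / (2 * (c - c')))
      rw [← hTdef, div_le_iff₀ (by linarith)] at h
      nlinarith [sq_nonneg c']
    have hnorm : ‖(T : ℂ) * ω‖ = T := by
      rw [norm_mul, hω, mul_one, Complex.norm_real, Real.norm_of_nonneg hT0.le]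
    obtain ⟨R, hR, hRn⟩ := exists_free_resolvent d (z := (T : ℂ) * ω)
      (by rw [Complex.re_ofReal_mul]; positivity) (norm_pos_iff.mp (hT0.trans_eq hnorm.symm))
    refine ⟨T, R, hT0, hR, hRn.trans_eq (by rw [hnorm]), ?_⟩
    refine ContinuousLinearMap.opNorm_le_bound _ (sub_nonneg.mpr hT) fun u => ?_
    refine Lp.norm_le_mul_norm_of_ae_le_mul ?_
    filter_upwards [coeFn_mulLinfty hq' u, Lp.coeFn_smul ((T : ℂ) * ω) u,
      Lp.coeFn_sub (mulLinfty d hq'.toLp u) (((T : ℂ) * ω) • u), hqC, hqc] with x h1 h2 h3 h4 h5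
    change ‖(mulLinfty d hq'.toLp u - ((T : ℂ) * ω) • u : L2Space d) x‖ ≤ _
    rw [h3, Pi.sub_apply, h1, h2, Pi.smul_apply, smul_eq_mul, ← sub_mul, norm_mul]
    gcongr
    exact norm_sub_le_of_le_re hω hT hTC hT0.le h4 h5
  obtain ⟨S, hS⟩ : ∃ S, IsShiftInverse (negLaplacian d) (mulLinfty d hq'.toLp) S := by
    obtain ⟨T, R, hT0, hR, hRn, hqT⟩ := key (c / 2) (by positivity) (by linarith)
    refine hR.exists_of_norm_lt ?_
    calc ‖mulLinfty d hq'.toLp - ((T : ℂ) * ω) • 1‖ * ‖R‖ ≤ (T - c / 2) * T⁻¹ := by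
          gcongr
          exact (norm_nonneg _).trans hqT
      _ < 1 := by
          rw [← div_eq_mul_inv, div_lt_one hT0]
          linarith
  -- Every `c' < c` gives the bound `1 / c'`; the sharp constant is the limit `c' → c`.
  refine ⟨S, hS, ContinuousLinearMap.opNorm_le_bound _ (by positivity) fun f => ?_⟩
  rw [inv_mul_eq_div, le_div_iff₀ hc, mul_comm]
  refine ContinuousWithinAt.closure_le (s := Set.Ioo 0 c) (f := fun c' => c' * ‖S f‖)
    (g := fun _ => ‖f‖) (x := c) ?_ (by fun_prop) (by fun_prop) ?_
  · rw [closure_Ioo hc.ne]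
    exact Set.right_mem_Icc.mpr hc.le
  · rintro c' ⟨h0, h1⟩
    obtain ⟨T, R, hT0, hR, hRn, hqT⟩ := key c' h0 h1
    exact hR.mul_norm_apply_le hS hT0 hRn hqT f

end SectorialPotentials

/-! ### The potentials `r ^ α * exp (i α β)` -/

section PolarPotentials

variable {d : ℕ}

theorem rpow_le_max_of_mem_Icc {r a b t : ℝ} (hr : 0 < r) (ht : t ∈ Set.Icc a b) :
    r ^ t ≤ max (r ^ a) (r ^ b) := by
  rcases le_total 1 r with h | h
  · exact (Real.rpow_le_rpow_of_exponent_le h ht.2).trans (le_max_right _ _)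
  · exact (Real.rpow_le_rpow_of_exponent_ge hr h ht.1).trans (le_max_left _ _)

theorem inv_max_rpow_neg_le {r a b t : ℝ} (hr : 0 < r) (ht : t ∈ Set.Icc a b) :
    (max (r ^ (-a)) (r ^ (-b)))⁻¹ ≤ r ^ t := by
  have h := rpow_le_max_of_mem_Icc (t := -t) (a := -b) (b := -a) hr
    ⟨neg_le_neg ht.2, neg_le_neg ht.1⟩
  rw [max_comm] at h
  rw [← inv_inv (r ^ t), ← Real.rpow_neg hr.le]
  exact inv_anti₀ (Real.rpow_pos_of_pos hr _) h

/-- The constant `C_β` bounds from below, uniformly in the order, the component of `exp (i t β)`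
along a fixed direction of the right half-plane: the positive axis if `β = 0`, and otherwise the
imaginary half-axis on the side of `β`, where the concavity of the sine on `[0, π]` reduces the
bound to the extreme orders. -/
theorem exists_direction_of_mem_Ioo {a b β : ℝ} (ha : 0 < a) (hab : a ≤ b) (hb : b < 1)
    (hβ : β ∈ Set.Ioo (-Real.pi) Real.pi) :
    ∃ ω : ℂ, ‖ω‖ = 1 ∧ 0 ≤ ω.re ∧ 0 < resolventConst a b β ∧ ∀ t ∈ Set.Icc a b,
      (resolventConst a b β)⁻¹ ≤
        (Complex.exp (Complex.I * (t : ℂ) * (β : ℂ)) * (starRingEnd ℂ) ω).re := by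
  rcases eq_or_ne β 0 with rfl | h0
  · exact ⟨1, by simp, by simp, by simp [resolventConst], fun t _ => by simp [resolventConst]⟩
  have habs : 0 < |β| := abs_pos.mpr h0
  have hπ : |β| < Real.pi := abs_lt.mpr hβ
  have hmem {t : ℝ} (ht0 : 0 < t) (ht1 : t < 1) : t * |β| ∈ Set.Ioo 0 Real.pi :=
    ⟨by positivity, by nlinarith⟩
  have hsin {t : ℝ} (ht0 : 0 < t) (ht1 : t < 1) : |Real.sin (t * β)| = Real.sin (t * |β|) := by
    have hp := Real.sin_pos_of_mem_Ioo (hmem ht0 ht1)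
    rcases abs_choice β with h | h
    · rw [h] at hp ⊢
      exact abs_of_pos hp
    · rw [h, mul_neg, Real.sin_neg] at hp ⊢
      exact abs_of_neg (neg_pos.mp hp)
  have hb0 : 0 < b := ha.trans_le hab
  have ha1 : a < 1 := hab.trans_lt hb
  have hpa := Real.sin_pos_of_mem_Ioo (hmem ha ha1)
  have hpb := Real.sin_pos_of_mem_Ioo (hmem hb0 hb)
  have hC : resolventConst a b β = max (Real.sin (a * |β|))⁻¹ (Real.sin (b * |β|))⁻¹ := by
    rw [resolventConst, if_neg h0, hsin ha ha1, hsin hb0 hb]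
  have hCpos : 0 < resolventConst a b β := by
    rw [hC]
    exact lt_max_of_lt_left (inv_pos.mpr hpa)
  have hmain {t : ℝ} (ht : t ∈ Set.Icc a b) : (resolventConst a b β)⁻¹ ≤ Real.sin (t * |β|) := by
    have hconc := strictConcaveOn_sin_Icc.concaveOn.min_le_of_mem_Icc
      (Set.Ioo_subset_Icc_self (hmem ha ha1)) (Set.Ioo_subset_Icc_self (hmem hb0 hb))
      (z := t * |β|) ⟨by gcongr; exact ht.1, by gcongr; exact ht.2⟩
    refine le_trans ?_ hconc
    rw [hC, le_min_iff]
    exact ⟨inv_le_of_inv_le₀ hpa (le_max_left _ _), inv_le_of_inv_le₀ hpb (le_max_right _ _)⟩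
  have hexp (t : ℝ) : Complex.exp (Complex.I * (t : ℂ) * (β : ℂ)) =
      (Real.cos (t * β) : ℂ) + (Real.sin (t * β) : ℂ) * Complex.I := by
    rw [mul_assoc, mul_comm, ← Complex.ofReal_mul, Complex.exp_mul_I, Complex.ofReal_cos,
      Complex.ofReal_sin]
  rcases abs_choice β with h | h
  · refine ⟨Complex.I, by simp, by simp, hCpos, fun t ht => (hmain ht).trans ?_⟩
    rw [hexp, h]
    simp [-Complex.ofReal_cos, -Complex.ofReal_sin]
  · refine ⟨-Complex.I, by simp, by simp, hCpos, fun t ht => (hmain ht).trans ?_⟩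
    rw [hexp, h]
    simp [-Complex.ofReal_cos, -Complex.ofReal_sin]

/-- The inverse for the polar potential, with the explicit bound: the orders `α x` may only be known
to lie in `[a, b]` almost everywhere, and `a = b` is allowed. -/
theorem exists_isBoundedInverse_polarPotential {α : RSpace d → ℝ} (hα : AEMeasurable α volume)
    {a b : ℝ} (ha : 0 < a) (hab : a ≤ b) (hb : b < 1) (hmem : ∀ᵐ x, α x ∈ Set.Icc a b)
    {r β : ℝ} (hr : 0 < r) (hβ : β ∈ Set.Ioo (-Real.pi) Real.pi) :
    ∃ R : L2Space d →L[ℂ] L2Space d,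
      IsBoundedInverse (schrodinger d (polarPotential α r β)) R ∧
        ‖R‖ ≤ resolventConst a b β * max (r ^ (-a)) (r ^ (-b)) := by
  obtain ⟨ω, hω, hω0, hC, hdir⟩ := exists_direction_of_mem_Ioo ha hab hb hβ
  have hmax : 0 < max (r ^ (-a)) (r ^ (-b)) := lt_max_of_lt_left (Real.rpow_pos_of_pos hr _)
  have hmeas : AEStronglyMeasurable (polarPotential α r β) volume := by
    have h1 : Measurable fun t : ℝ =>
        ((r ^ t : ℝ) : ℂ) * Complex.exp (Complex.I * (t : ℂ) * (β : ℂ)) := by fun_prop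
    exact (h1.comp_aemeasurable hα).aestronglyMeasurable
  obtain ⟨R, hR, hRn⟩ := exists_isBoundedInverse_of_le_re hmeas hω hω0
    (c := (resolventConst a b β * max (r ^ (-a)) (r ^ (-b)))⁻¹) (C := max (r ^ a) (r ^ b))
    (by positivity)
    (by
      filter_upwards [hmem] with x hx
      rw [polarPotential, norm_mul, Complex.norm_real,
        Real.norm_of_nonneg (Real.rpow_nonneg hr.le _), mul_assoc, mul_comm Complex.I,
        ← Complex.ofReal_mul, Complex.norm_exp_ofReal_mul_I, mul_one]
      exact rpow_le_max_of_mem_Icc hr hx)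
    (by
      filter_upwards [hmem] with x hx
      rw [polarPotential, mul_assoc, Complex.re_ofReal_mul, mul_inv, mul_comm]
      gcongr
      · exact inv_max_rpow_neg_le hr hx
      · exact hdir _ hx)
  exact ⟨R, hR, by rwa [inv_inv] at hRn⟩

end PolarPotentials

/-! ### Holomorphy in the spectral parameter -/

section Holomorphy

variable {d : ℕ}

/-- The potential `p ^ α` is the polar potential at the polar coordinates of `p`. -/
theorem powerPotential_eq_polarPotential (α : RSpace d → ℝ) {p : ℂ} (hp : p ≠ 0) :
    powerPotential α p = polarPotential α ‖p‖ p.arg := by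
  ext x
  rw [powerPotential, polarPotential, Complex.cpow_def_of_ne_zero hp,
    Real.rpow_def_of_pos (norm_pos_iff.mpr hp), Complex.ofReal_exp, ← Complex.exp_add]
  congr 1
  rw [Complex.log]
  push_cast
  ring

theorem norm_exp_ofReal_mul_le {t : ℝ} (ht : |t| ≤ 1) (w : ℂ) :
    ‖Complex.exp (t * w)‖ ≤ Real.exp ‖w‖ := by
  rw [Complex.norm_exp]
  gcongr
  refine (Complex.re_le_norm _).trans ?_
  rw [norm_mul, Complex.norm_real, Real.norm_eq_abs]
  exact mul_le_of_le_one_left (norm_nonneg _) ht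

theorem memLp_top_exp_mul {α : RSpace d → ℝ} (hα : AEMeasurable α volume)
    (hα1 : ∀ᵐ x, |α x| ≤ 1) (w : ℂ) :
    MemLp (fun x => Complex.exp (α x * w)) ∞ volume := by
  have h1 : Measurable fun t : ℝ => Complex.exp (t * w) := by fun_prop
  refine memLp_top_of_bound (h1.comp_aemeasurable hα).aestronglyMeasurable (Real.exp ‖w‖) ?_
  filter_upwards [hα1] with x hx
  exact norm_exp_ofReal_mul_le hx w

/-- The multiplication operator by `exp (α w)`, with `|α| ≤ 1`, is an entire function of `w`. -/
theorem differentiable_mulLinfty_exp {α : RSpace d → ℝ} (hα : AEMeasurable α volume)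
    (hα1 : ∀ᵐ x, |α x| ≤ 1) :
    Differentiable ℂ fun w => mulLinfty d (memLp_top_exp_mul hα hα1 w).toLp := by
  intro w₀
  have hαtop : MemLp (fun x => (α x : ℂ)) ∞ volume :=
    memLp_top_of_bound (Complex.measurable_ofReal.comp_aemeasurable hα).aestronglyMeasurable 1
      (by simpa using hα1)
  have hD : MemLp (fun x => (α x : ℂ) * Complex.exp (α x * w₀)) ∞ volume :=
    (memLp_top_exp_mul hα hα1 w₀).mul hαtop
  refine HasDerivAt.differentiableAt (f' := mulLinfty d hD.toLp) ?_
  rw [hasDerivAt_iff_isLittleO]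
  refine Asymptotics.IsBigO.trans_isLittleO (g := fun w => ‖w - w₀‖ ^ 2) ?_
    (Asymptotics.isLittleO_pow_sub_sub w₀ one_lt_two)
  refine Asymptotics.IsBigO.of_bound (Real.exp ‖w₀‖) ?_
  filter_upwards [Metric.closedBall_mem_nhds w₀ one_pos] with w hw
  rw [mem_closedBall_iff_norm] at hw
  have hrem := ((memLp_top_exp_mul hα hα1 w).sub (memLp_top_exp_mul hα hα1 w₀)).sub
    (hD.const_smul (w - w₀))
  have heq : mulLinfty d (memLp_top_exp_mul hα hα1 w).toLp -
      mulLinfty d (memLp_top_exp_mul hα hα1 w₀).toLp - (w - w₀) • mulLinfty d hD.toLp =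
        mulLinfty d hrem.toLp := by
    rw [← map_smul, ← map_sub, ← map_sub]
    rfl
  rw [heq, norm_pow, norm_norm]
  refine norm_mulLinfty_le hrem (by positivity) ?_
  filter_upwards [hα1] with x hx
  have hle : ‖(α x : ℂ) * (w - w₀)‖ ≤ ‖w - w₀‖ := by
    rw [norm_mul, Complex.norm_real, Real.norm_eq_abs]
    exact mul_le_of_le_one_left (norm_nonneg _) hx
  have hle₀ : ‖Complex.exp (α x * w₀)‖ ≤ Real.exp ‖w₀‖ :=
    norm_exp_ofReal_mul_le hx w₀
  have hfac : Complex.exp (α x * w) =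
      Complex.exp (α x * w₀) * Complex.exp (α x * (w - w₀)) := by
    rw [← Complex.exp_add]
    ring_nf
  calc ‖Complex.exp (α x * w) - Complex.exp (α x * w₀) -
        (w - w₀) • ((α x : ℂ) * Complex.exp (α x * w₀))‖
      = ‖Complex.exp (α x * w₀) *
          (Complex.exp (α x * (w - w₀)) - 1 - α x * (w - w₀))‖ := by
        rw [hfac, smul_eq_mul]
        ring_nf
    _ ≤ Real.exp ‖w₀‖ * ‖w - w₀‖ ^ 2 := by
        rw [norm_mul]
        gcongr
        exact (Complex.norm_exp_sub_one_sub_id_le (hle.trans hw)).trans (by gcongr)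

/-- The resolvent family is holomorphic: `p ^ α = exp (α log p)` is holomorphic as a family of
multiplication operators, and so is the inverse of a holomorphic family. -/
theorem exists_differentiableOn_inverse_powerPotential {α : RSpace d → ℝ}
    (hα : AEMeasurable α volume) {a b : ℝ} (ha : 0 < a) (hab : a ≤ b) (hb : b < 1)
    (hmem : ∀ᵐ x, α x ∈ Set.Icc a b) :
    ∃ R : ℂ → (L2Space d →L[ℂ] L2Space d),
      (∀ p ∈ Complex.slitPlane,
        IsBoundedInverse (schrodinger d (powerPotential α p)) (R p)) ∧
      DifferentiableOn ℂ R Complex.slitPlane := by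
  have hex (p : ℂ) (hp : p ∈ Complex.slitPlane) : ∃ R : L2Space d →L[ℂ] L2Space d,
      IsBoundedInverse (schrodinger d (powerPotential α p)) R := by
    rw [powerPotential_eq_polarPotential α (Complex.slitPlane_ne_zero hp)]
    obtain ⟨R, hR, -⟩ := exists_isBoundedInverse_polarPotential hα ha hab hb hmem
      (norm_pos_iff.mpr (Complex.slitPlane_ne_zero hp))
      ⟨Complex.neg_pi_lt_arg p,
        lt_of_le_of_ne (Complex.arg_le_pi p) (Complex.slitPlane_arg_ne_pi hp)⟩
    exact ⟨R, hR⟩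
  choose! R hR using hex
  refine ⟨R, hR, ?_⟩
  have hα1 : ∀ᵐ x, |α x| ≤ 1 := by
    filter_upwards [hmem] with x hx
    rw [abs_of_nonneg (ha.le.trans hx.1)]
    exact hx.2.trans hb.le
  have hinv (p : ℂ) (hp : p ∈ Complex.slitPlane) : IsShiftInverse (negLaplacian d)
      (mulLinfty d (memLp_top_exp_mul hα hα1 (Complex.log p)).toLp) (R p) := by
    have heq : powerPotential α p = fun x => Complex.exp (α x * Complex.log p) := by
      ext x
      rw [powerPotential, Complex.cpow_def_of_ne_zero (Complex.slitPlane_ne_zero hp), mul_comm]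
    have h := hR p hp
    rw [heq] at h
    exact (isBoundedInverse_schrodinger_iff _ _).mp h
  refine (hinv 1 Complex.one_mem_slitPlane).differentiableOn ?_ hinv
  exact (differentiable_mulLinfty_exp hα hα1).comp_differentiableOn
    fun p hp => (Complex.differentiableAt_log hp).differentiableWithinAt

end Holomorphy

/-! ### The variable order -/

section VariableOrder

variable {d : ℕ}

theorem ae_variableOrder {K : Set (RSpace d)} (hK : MeasurableSet K) {κ : RSpace d → ℝ} {αs : ℝ}
    {P : ℝ → Prop} (hκ : ∀ᵐ x ∂(volume.restrict K), P (κ x)) (hs : P αs) :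
    ∀ᵐ x, P (variableOrder K κ αs x) := by
  filter_upwards [(ae_restrict_iff' hK).mp hκ] with x hx
  by_cases h : x ∈ K
  · rw [variableOrder, if_pos h]
    exact hx h
  · rwa [variableOrder, if_neg h]

theorem aemeasurable_variableOrder {K : Set (RSpace d)} (hK : MeasurableSet K)
    {κ : RSpace d → ℝ} (αs : ℝ) (hκ : AEMeasurable κ (volume.restrict K)) :
    AEMeasurable (variableOrder K κ αs) volume := by
  classical
  have h : variableOrder K κ αs = K.indicator κ + Kᶜ.indicator fun _ => αs := by
    ext x
    by_cases hx : x ∈ K <;> simp [variableOrder, hx]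
  rw [h]
  exact ((aemeasurable_indicator_iff hK).mpr hκ).add
    ((aemeasurable_indicator_iff hK.compl).mpr aemeasurable_const)

end VariableOrder

theorem proposition2p1 (d : ℕ) (hd : 2 ≤ d)
    (K : Set (RSpace d)) (hK : IsCompact K)
    (αm αM αs : ℝ) (hm : 0 < αm) (hmM : αm < αM) (hM : αM < 1) (hs : αs ∈ Set.Icc αm αM)
    (κ : RSpace d → ℝ) (hκ : AEMeasurable κ (volume.restrict K))
    (hκ_mem : ∀ᵐ x ∂(volume.restrict K), κ x ∈ Set.Icc αm αM) :
    -- general case: the variable order `α`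
    ((∀ r : ℝ, 0 < r → ∀ β ∈ Set.Ioo (-Real.pi) Real.pi,
        ∃ R : L2Space d →L[ℂ] L2Space d,
          IsBoundedInverse (schrodinger d (polarPotential (variableOrder K κ αs) r β)) R ∧
          ‖R‖ ≤ resolventConst αm αM β * max (r ^ (-αm)) (r ^ (-αM))) ∧
      (∃ R : ℂ → (L2Space d →L[ℂ] L2Space d),
        (∀ p ∈ Complex.slitPlane,
          IsBoundedInverse (schrodinger d (powerPotential (variableOrder K κ αs) p)) (R p)) ∧
        DifferentiableOn ℂ R Complex.slitPlane)) ∧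
    -- constant case: `κ` equals `αs` on `K`
    ((∀ᵐ x ∂(volume.restrict K), κ x = αs) →
      (∀ᵐ x, variableOrder K κ αs x = αs) ∧
      (∀ r : ℝ, 0 < r → ∀ β ∈ Set.Ioo (-Real.pi) Real.pi,
        ∃ R : L2Space d →L[ℂ] L2Space d,
          IsBoundedInverse (schrodinger d (polarPotential (fun _ => αs) r β)) R ∧
          ‖R‖ ≤ resolventConst αs αs β * r ^ (-αs)) ∧
      (∃ R : ℂ → (L2Space d →L[ℂ] L2Space d),
        (∀ p ∈ Complex.slitPlane,
          IsBoundedInverse (schrodinger d (powerPotential (fun _ => αs) p)) (R p)) ∧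
        DifferentiableOn ℂ R Complex.slitPlane)) := by
  have hmem := ae_variableOrder (αs := αs) hK.measurableSet hκ_mem hs
  have hmeas := aemeasurable_variableOrder hK.measurableSet αs hκ
  have hs0 : 0 < αs := hm.trans_le hs.1
  have hs1 : αs < 1 := hs.2.trans_lt hM
  have hconst : ∀ᵐ _ : RSpace d, αs ∈ Set.Icc αs αs :=
    Filter.Eventually.of_forall fun _ => ⟨le_rfl, le_rfl⟩
  refine ⟨⟨fun r hr β hβ => exists_isBoundedInverse_polarPotential hmeas hm hmM.le hM hmem hr hβ,
    exists_differentiableOn_inverse_powerPotential hmeas hm hmM.le hM hmem⟩, fun h => ⟨?_, ?_, ?_⟩⟩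
  · exact ae_variableOrder (P := fun t => t = αs) hK.measurableSet h rfl
  · intro r hr β hβ
    simpa only [max_self] using exists_isBoundedInverse_polarPotential (d := d)
      (α := fun _ => αs) aemeasurable_const hs0 le_rfl hs1 hconst hr hβ
  · exact exists_differentiableOn_inverse_powerPotential (α := fun _ => αs) aemeasurable_const hs0
      le_rfl hs1 hconst
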